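/- Let $G$ be a finite-dimensional (real, smooth, Hausdorff) Lie group with Lie algebra $\mathfrak g=T_1G$, the bracket being that of left-invariant vector fields, and let $\exp:\mathfrak g\to G$ be the exponential map: $\exp(u)=\gamma_u(1)$, where $\gamma_u:\mathbb R\to G$ is the integral curve of the left-invariant vector field generated by $u$ with $\gamma_u(0)=1$. For $h\in G$ let $R_h:G\to G$, $R_h(g)=gh$; for $w\in\mathfrak g$ write $w\cdot h:=T_1R_h(w)\in T_hG$; and let $\mathrm{ad}_u(v)=[u,v]$. Let $$\mathrm{dexp}_u:=T_{\exp(u)}R_{\exp(-u)}\circ T_u\exp:\ \mathfrak g\to\mathfrak g$$ be the right-trivialised tangent map of $\exp$. Then $\exp$ is differentiable, and for all $u\in\mathfrak g$ and $v\in T_u\mathfrak g\simeq\mathfrak g$, $$T_u\exp(v)=\left.\frac{\mathrm d}{\mathrm ds}\right|_{s=0}\exp(u+sv)=T_1R_{\exp(u)}\bigl(\mathrm{dexp}_u(v)\bigr)=\mathrm{dexp}_u(v)\cdot\exp(u),$$ where $$\mathrm{dexp}_u(v)=\int_0^1\exp(r\,\mathrm{ad}_u)(v)\,\mathrm dr=\left.\frac{e^z-1}{z}\right|_{z=\mathrm{ad}_u}(v).$$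 Here $\exp(r\,\mathrm{ad}_u)$ is the exponential of the linear operator $r\,\mathrm{ad}_u$ on $\mathfrak g$, and $f|_{z=\mathrm{ad}_u}:=\sum_{k\ge 0}\frac{f^{(k)}(0)}{k!}\,\mathrm{ad}_u^k$ (a convergent series of operators) for the entire function $f(z)=(e^z-1)/z$, $f(0)=1$. -/

import Mathlib

open scoped Manifold ContDiff Nat

noncomputable section

namespace LieExp

section Exponential

variable {E : Type*} [NormedAddCommGroup E] [NormedSpace ℝ E]
  {H : Type*} [TopologicalSpace H] {I : ModelWithCorners ℝ E H}
  {G : Type*} [TopologicalSpace G] [ChartedSpace H G] [Group G]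

/-- The Lie algebra `𝔤 = T₁G` is, as a vector space, the model space `E`, and gets its norm. When
`E` is finite-dimensional (as everywhere below) nothing depends on this choice of a norm. -/
instance instNormedAddCommGroupLieAlg : NormedAddCommGroup (GroupLieAlgebra I G) where
  __ := (inferInstance : AddCommGroup (GroupLieAlgebra I G))
  norm := (norm : E → ℝ)
  toMetricSpace := (inferInstance : MetricSpace E).replaceTopology
    (U := instTopologicalSpaceTangentSpace I (1 : G)) rfl
  dist_eq := dist_eq_norm_neg_add (E := E)

instance instNormedSpaceLieAlg : NormedSpace ℝ (GroupLieAlgebra I G) where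
  norm_smul_le := norm_smul_le (α := ℝ) (β := E)

instance instFiniteDimensionalLieAlg [FiniteDimensional ℝ E] : FiniteDimensional ℝ (GroupLieAlgebra I G) :=
  inferInstanceAs (FiniteDimensional ℝ E)

variable [LieGroup I ∞ G]

/-- A smooth Lie group has the regularity that the bracket on `GroupLieAlgebra I G` asks for. -/
instance instLieGroupMinSmoothness : LieGroup I (minSmoothness ℝ 3) G := by
  simp only [minSmoothness_of_isRCLikeNormedField]; infer_instance

theorem mulInvariantVectorField_mul (u : GroupLieAlgebra I G) (g h : G) :
    mulInvariantVectorField u (g * h) =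
      mfderiv I I (fun x : G => g * x) h (mulInvariantVectorField u h) := by
  have hd (a b : G) : MDifferentiableAt I I (fun x : G => a * x) b :=
    (contMDiff_mul_left (I := I) (n := ∞) (a := a)).mdifferentiableAt (by simp)
  have h1 : (fun x : G => g * h * x) = (fun x => g * x) ∘ fun x => h * x := by
    ext x; simp [mul_assoc]
  simp only [mulInvariantVectorField]
  rw [h1, mfderiv_comp (1 : G) (I' := I) (hd _ _) (hd _ _)]
  have key (k : G) (hk : k = h) (X : E) : (mfderiv I I (fun x : G => g * x) k : E → E) X =
      (mfderiv I I (fun x : G => g * x) h : E → E) X := by rw [hk]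
  exact key _ (mul_one h) _

variable [FiniteDimensional ℝ E]

/-- `ad_u = [u, ·]`, as a continuous linear endomorphism of the finite-dimensional space `𝔤`. -/
def adL (u : GroupLieAlgebra I G) : GroupLieAlgebra I G →L[ℝ] GroupLieAlgebra I G :=
  haveI : CompleteSpace E := FiniteDimensional.complete ℝ E
  LinearMap.toContinuousLinearMap
    (LieAlgebra.ad ℝ (GroupLieAlgebra I G) u : Module.End ℝ (GroupLieAlgebra I G))

theorem adL_apply (u v : GroupLieAlgebra I G) : adL u v = ⁅u, v⁆ := rfl

variable [I.Boundaryless] [T2Space G]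

/-- The left-invariant vector field generated by `u` has exactly one integral curve that is defined
for all times and starts at the identity. -/
theorem existsUnique_integralCurve (u : GroupLieAlgebra I G) :
    ∃! γ : ℝ → G, γ 0 = 1 ∧ IsMIntegralCurve (I := I) γ (mulInvariantVectorField u) := by
  have : IsManifold I 1 G := inferInstance
  have : CompleteSpace E := FiniteDimensional.complete ℝ E
  have hv : ContMDiff I I.tangent 1
      (fun g : G ↦ (⟨g, mulInvariantVectorField u g⟩ : TangentBundle I G)) :=
    (contMDiff_mulInvariantVectorField u).of_le (by simp)
  have htrans {γ : ℝ → G} {s : Set ℝ} (g : G)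
      (h : IsMIntegralCurveOn (I := I) γ (mulInvariantVectorField u) s) :
      IsMIntegralCurveOn (I := I) (fun t => g * γ t) (mulInvariantVectorField u) s := by
    intro t ht
    have h1 : HasMFDerivAt I I (fun x : G => g * x) (γ t)
        (mfderiv I I (fun x : G => g * x) (γ t)) :=
      ((contMDiff_mul_left (I := I) (n := ∞) (a := g)).mdifferentiableAt (by simp)).hasMFDerivAt
    refine (h1.comp_hasMFDerivWithinAt t (h t ht)).congr_mfderiv ?_
    rw [mulInvariantVectorField_mul]
    ext
    exact (map_smul (mfderiv I I (fun x : G => g * x) (γ t)) (1 : ℝ) _)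
  obtain ⟨γ₀, h0, hγ₀⟩ := exists_isMIntegralCurveAt_of_contMDiffAt_boundaryless (t₀ := 0)
    (hv.contMDiffAt (x := (1 : G)))
  obtain ⟨ε, hε, hγ⟩ := isMIntegralCurveAt_iff'.1 hγ₀
  obtain ⟨γ, h1, hγ⟩ := exists_isMIntegralCurve_of_isMIntegralCurveOn hv hε
    (fun g => ⟨fun t => g * γ₀ t, by simp [h0], htrans g (by simpa [Real.ball_eq_Ioo] using hγ)⟩) 1
  exact ⟨γ, ⟨h1, hγ⟩, fun γ' h' => isMIntegralCurve_Ioo_eq_of_contMDiff_boundaryless (t₀ := 0) hv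
    h'.2 hγ (by rw [h'.1, h1])⟩

/-- The exponential map `exp : 𝔤 → G`: the value at time `1` of the integral curve, starting at the
identity, of the left-invariant vector field generated by `u` (that is, of the one-parameter
subgroup with initial velocity `u`). -/
def lieExp (u : GroupLieAlgebra I G) : G := (existsUnique_integralCurve u).choose 1

/-- The tangent map `T_u exp : T_u 𝔤 ≃ 𝔤 → T_{exp u} G`. -/
def tangentExp (u : GroupLieAlgebra I G) : GroupLieAlgebra I G →L[ℝ] TangentSpace I (lieExp u) :=
  mfderiv 𝓘(ℝ, GroupLieAlgebra I G) I (lieExp : GroupLieAlgebra I G → G) u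

/-- The right-trivialised differential of the exponential map,
`dexp_u = T_{exp u} R_{exp (-u)} ∘ T_u exp : 𝔤 → 𝔤`, with `R_h g = g * h`. The target of
`T_{exp u} R_{exp (-u)}` is the tangent space at `exp u * exp (-u) = 1`. -/
def dexp (u : GroupLieAlgebra I G) : GroupLieAlgebra I G →L[ℝ] GroupLieAlgebra I G :=
  (mfderiv I I (fun g : G => g * lieExp (-u)) (lieExp u)).comp (tangentExp u)

end Exponential

section FunctionalCalculus

/-- The entire function `(e ^ z - 1) / z`, with its removable singularity at `0` filled in. -/
def phi (z : ℝ) : ℝ := if z = 0 then 1 else (Real.exp z - 1) / z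

/-- `B = f(A)`, where `f` is an entire function with real Taylor coefficients: `f` is the sum of its
Taylor series `∑ c_k z ^ k` at `0` on the whole line, and `B = ∑ c_k A ^ k`. -/
def IsEntireEval {V : Type*} [NormedAddCommGroup V] [NormedSpace ℝ V]
    (f : ℝ → ℝ) (A B : V →L[ℝ] V) : Prop :=
  (∀ z : ℝ, HasSum (fun k : ℕ => iteratedDeriv k f 0 / (k ! : ℝ) * z ^ k) (f z)) ∧
    HasSum (fun k : ℕ => (iteratedDeriv k f 0 / (k ! : ℝ)) • A ^ k) B

end FunctionalCalculus

end LieExp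

end

namespace LieExp

section Analysis

variable {V : Type*} [NormedAddCommGroup V] [NormedSpace ℝ V]

/-- The operator `∑ A ^ k / (k + 1)!`, that is `(e ^ z - 1) / z` at `z = A`. -/
noncomputable def phiSeries (A : V →L[ℝ] V) : V →L[ℝ] V :=
  ∑' k : ℕ, (((k + 1)! : ℝ)⁻¹) • A ^ k

theorem summable_norm_phiSeries (A : V →L[ℝ] V) :
    Summable fun k : ℕ => ‖(((k + 1)! : ℝ)⁻¹) • A ^ k‖ := by
  refine Summable.of_nonneg_of_le (fun _ => norm_nonneg _) (fun k => ?_)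
    (NormedSpace.norm_expSeries_summable' (𝕂 := ℝ) A)
  rw [norm_smul, norm_smul]
  gcongr
  simp only [norm_inv, RCLike.norm_natCast]
  gcongr
  omega

variable [CompleteSpace V]

theorem eq_exp_smul_apply_of_hasDerivAt (A : V →L[ℝ] V) {f : ℝ → V}
    (hf : ∀ t, HasDerivAt f (A (f t)) t) (t : ℝ) :
    f t = NormedSpace.exp (t • A) (f 0) := by
  have key (s : ℝ) : HasDerivAt (fun s : ℝ => NormedSpace.exp (s • (-A)) (f s)) 0 s := by
    have h := (hasDerivAt_exp_smul_const (𝕂 := ℝ) (-A) s).clm_apply (hf s)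
    simpa using h
  have hc := is_const_of_deriv_eq_zero (fun s => (key s).differentiableAt)
    (fun s => (key s).deriv) t 0
  simp only [zero_smul, NormedSpace.exp_zero, one_apply_eq_self] at hc
  have hinv : NormedSpace.exp (t • A) * NormedSpace.exp (t • (-A)) = 1 := by
    let : NormedAlgebra ℚ (V →L[ℝ] V) := NormedAlgebra.restrictScalars ℚ ℝ _
    rw [← NormedSpace.exp_add_of_commute (((Commute.refl A).neg_right.smul_left t).smul_right t)]
    simp
  rw [← hc, ← mul_apply_eq_comp, hinv, one_apply_eq_self]

theorem hasSum_exp_smul (A : V →L[ℝ] V) (r : ℝ) :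
    HasSum (fun k : ℕ => (r ^ k / (k ! : ℝ)) • A ^ k) (NormedSpace.exp (r • A)) := by
  have h := NormedSpace.exp_series_hasSum_exp' (𝕂 := ℝ) (r • A)
  simpa only [smul_pow, smul_smul, ← div_eq_inv_mul] using h

theorem hasSum_phiSeries (A : V →L[ℝ] V) :
    HasSum (fun k : ℕ => (((k + 1)! : ℝ)⁻¹) • A ^ k) (phiSeries A) :=
  (summable_norm_phiSeries A).of_norm.hasSum

theorem continuous_exp_smul (A : V →L[ℝ] V) :
    Continuous fun r : ℝ => NormedSpace.exp (r • A) :=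
  continuous_iff_continuousAt.2 fun r =>
    (hasDerivAt_exp_smul_const (𝕂 := ℝ) A r).continuousAt

theorem continuous_exp_smul_apply (A : V →L[ℝ] V) (v : V) :
    Continuous fun r : ℝ => NormedSpace.exp (r • A) v :=
  (continuous_exp_smul A).clm_apply continuous_const

theorem exists_norm_exp_smul_apply_le (A : V →L[ℝ] V) :
    ∃ M : ℝ, 0 < M ∧ ∀ r ∈ Set.Icc (0 : ℝ) 1, ∀ v, ‖NormedSpace.exp (r • A) v‖ ≤ M * ‖v‖ := by
  obtain ⟨M, hM⟩ := isCompact_Icc.exists_bound_of_continuousOn (s := Set.Icc (0 : ℝ) 1)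
    (continuous_exp_smul A).continuousOn
  exact ⟨max M 1, by positivity, fun r hr v =>
    ContinuousLinearMap.le_of_opNorm_le _ ((hM r hr).trans (le_max_left _ _)) v⟩

theorem phiSeries_apply (A : V →L[ℝ] V) (v : V) :
    phiSeries A v = ∫ r in (0 : ℝ)..1, NormedSpace.exp (r • A) v := by
  have h2 : HasSum (fun k : ℕ => ∫ r in (0 : ℝ)..1, (r ^ k / (k ! : ℝ)) • (A ^ k) v)
      (∫ r in (0 : ℝ)..1, NormedSpace.exp (r • A) v) := by
    refine intervalIntegral.hasSum_integral_of_dominated_convergence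
      (fun k _ => ‖((k ! : ℝ)⁻¹) • A ^ k‖ * ‖v‖) (fun k => ?_) (fun k => ?_) ?_ ?_ ?_
    · exact (Continuous.aestronglyMeasurable (by fun_prop))
    · refine Filter.Eventually.of_forall fun r hr => ?_
      rw [Set.uIoc_of_le zero_le_one] at hr
      have hr1 : r ^ k ≤ 1 := pow_le_one₀ hr.1.le hr.2
      have hr0 : 0 ≤ r ^ k := pow_nonneg hr.1.le k
      calc ‖(r ^ k / (k ! : ℝ)) • (A ^ k) v‖ = r ^ k * ‖(((k ! : ℝ)⁻¹) • A ^ k) v‖ := by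
            rw [div_eq_mul_inv, mul_smul, norm_smul, Real.norm_of_nonneg hr0]; rfl
        _ ≤ 1 * (‖((k ! : ℝ)⁻¹) • A ^ k‖ * ‖v‖) := by
            gcongr; exact ContinuousLinearMap.le_opNorm _ _
        _ = _ := one_mul _
    · exact Filter.Eventually.of_forall fun r _ =>
        (NormedSpace.norm_expSeries_summable' (𝕂 := ℝ) A).mul_right _
    · exact intervalIntegrable_const
    · exact Filter.Eventually.of_forall fun r _ =>
        (hasSum_exp_smul A r).mapL (ContinuousLinearMap.apply ℝ V v)
  refine ((hasSum_phiSeries A).mapL (ContinuousLinearMap.apply ℝ V v)).unique ?_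
  convert h2 using 2 with k
  rw [intervalIntegral.integral_smul_const, intervalIntegral.integral_div, integral_pow]
  simp only [ContinuousLinearMap.apply_apply, smul_apply]
  congr 1
  rw [Nat.factorial_succ]
  push_cast
  field_simp
  simp

theorem hasSum_phi (z : ℝ) : HasSum (fun k : ℕ => ((k + 1)! : ℝ)⁻¹ * z ^ k) (phi z) := by
  by_cases hz : z = 0
  · subst hz
    convert hasSum_single (f := fun k : ℕ => ((k + 1)! : ℝ)⁻¹ * (0 : ℝ) ^ k) 0 ?_ using 1
    · simp [phi]
    · intro k hk; simp [hk]
  · have h := NormedSpace.expSeries_div_hasSum_exp (𝔸 := ℝ) z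
    rw [← Real.exp_eq_exp_ℝ] at h
    have h1 := ((hasSum_nat_add_iff' 1).2 h).div_const z
    simp only [Finset.range_one, Finset.sum_singleton, pow_zero, Nat.factorial_zero, Nat.cast_one,
      div_one] at h1
    simp only [phi, if_neg hz]
    have h2 : (fun k : ℕ => ((k + 1)! : ℝ)⁻¹ * z ^ k) =
        fun k : ℕ => z ^ (k + 1) / ((k + 1)! : ℝ) / z := by
      funext k
      rw [pow_succ]
      field_simp
    rw [h2]
    exact h1

theorem iteratedDeriv_phi_zero_div (k : ℕ) :
    iteratedDeriv k phi 0 / (k ! : ℝ) = ((k + 1)! : ℝ)⁻¹ := by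
  have hs : HasFPowerSeriesOnBall phi
      (FormalMultilinearSeries.ofScalars ℝ fun k : ℕ => ((k + 1)! : ℝ)⁻¹) 0 ⊤ := by
    refine ⟨?_, by simp, fun {y} _ => ?_⟩
    · refine le_of_eq (Eq.symm ?_)
      refine FormalMultilinearSeries.radius_eq_top_of_summable_norm _ fun r => ?_
      refine ((hasSum_phi (r : ℝ)).summable.norm).of_nonneg_of_le (fun _ => by positivity)
        fun n => ?_
      rw [FormalMultilinearSeries.ofScalars_norm, norm_mul, norm_pow]
      simp
    · simpa [FormalMultilinearSeries.ofScalars_apply_eq, mul_comm] using hasSum_phi y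
  have h2 := hs.hasFPowerSeriesAt.eq_formalMultilinearSeries
    hs.hasFPowerSeriesAt.analyticAt.hasFPowerSeriesAt
  have h3 := congrArg (fun p => FormalMultilinearSeries.coeff p k) h2
  simpa [FormalMultilinearSeries.coeff_ofScalars] using h3.symm

theorem isEntireEval_phi (A : V →L[ℝ] V) : IsEntireEval phi A (phiSeries A) := by
  simp only [IsEntireEval, iteratedDeriv_phi_zero_div]
  exact ⟨hasSum_phi, hasSum_phiSeries A⟩

end Analysis

section Calculus

open Filter Topology Set

variable {E : Type*} [NormedAddCommGroup E] [NormedSpace ℝ E]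

theorem eventually_fderiv_prodMk_left {M : E × E → E} {e : E} (hM : ContDiffAt ℝ 2 M (e, e)) :
    (fun x => fderiv ℝ (fun y => M (x, y)) e) =ᶠ[𝓝 e]
      fun x => (fderiv ℝ M (x, e)).comp (ContinuousLinearMap.inr ℝ E E) := by
  have ht : Tendsto (fun x : E => (x, e)) (𝓝 e) (𝓝 (e, e)) :=
    Continuous.tendsto (f := fun x : E => (x, e)) (by fun_prop) e
  filter_upwards [ht.eventually (hM.eventually (by simp))] with x hx
  exact ((hx.differentiableAt (by simp)).hasFDerivAt.comp e (hasFDerivAt_prodMk_right x e)).fderiv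

theorem eventually_fderiv_prodMk_right {M : E × E → E} {e : E} (hM : ContDiffAt ℝ 2 M (e, e)) :
    (fun x => fderiv ℝ (fun z => M (z, x)) e) =ᶠ[𝓝 e]
      fun x => (fderiv ℝ M (e, x)).comp (ContinuousLinearMap.inl ℝ E E) := by
  have ht : Tendsto (fun x : E => (e, x)) (𝓝 e) (𝓝 (e, e)) :=
    Continuous.tendsto (f := fun x : E => (e, x)) (by fun_prop) e
  filter_upwards [ht.eventually (hM.eventually (by simp))] with x hx
  exact ((hx.differentiableAt (by simp)).hasFDerivAt.comp e (hasFDerivAt_prodMk_left e x)).fderiv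

theorem hasFDerivAt_fderiv_prodMk_left {M : E × E → E} {e : E} (hM : ContDiffAt ℝ 2 M (e, e)) :
    HasFDerivAt (fun x => fderiv ℝ (fun y => M (x, y)) e)
      (((ContinuousLinearMap.compL ℝ E (E × E) E).flip (ContinuousLinearMap.inr ℝ E E)).comp
        ((fderiv ℝ (fderiv ℝ M) (e, e)).comp (ContinuousLinearMap.inl ℝ E E))) e := by
  refine HasFDerivAt.congr_of_eventuallyEq ?_ (eventually_fderiv_prodMk_left hM)
  have h1 : HasFDerivAt (fderiv ℝ M) (fderiv ℝ (fderiv ℝ M) (e, e)) (e, e) :=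
    ((hM.fderiv_right (m := 1) (by norm_num)).differentiableAt (by simp)).hasFDerivAt
  exact (((ContinuousLinearMap.compL ℝ E (E × E) E).flip
    (ContinuousLinearMap.inr ℝ E E)).hasFDerivAt).comp e
      (h1.comp (f := fun x => (x, e)) e (hasFDerivAt_prodMk_left e e))

theorem hasFDerivAt_fderiv_prodMk_right {M : E × E → E} {e : E} (hM : ContDiffAt ℝ 2 M (e, e)) :
    HasFDerivAt (fun x => fderiv ℝ (fun z => M (z, x)) e)
      (((ContinuousLinearMap.compL ℝ E (E × E) E).flip (ContinuousLinearMap.inl ℝ E E)).comp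
        ((fderiv ℝ (fderiv ℝ M) (e, e)).comp (ContinuousLinearMap.inr ℝ E E))) e := by
  refine HasFDerivAt.congr_of_eventuallyEq ?_ (eventually_fderiv_prodMk_right hM)
  have h1 : HasFDerivAt (fderiv ℝ M) (fderiv ℝ (fderiv ℝ M) (e, e)) (e, e) :=
    ((hM.fderiv_right (m := 1) (by norm_num)).differentiableAt (by simp)).hasFDerivAt
  exact (((ContinuousLinearMap.compL ℝ E (E × E) E).flip
    (ContinuousLinearMap.inl ℝ E E)).hasFDerivAt).comp e (h1.comp e (hasFDerivAt_prodMk_right e e))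

theorem fderiv_eq_id_of_eventually_eq {f : E → E} {e : E} (h : ∀ᶠ x in 𝓝 e, f x = x) :
    fderiv ℝ f e = ContinuousLinearMap.id ℝ E := by
  rw [EventuallyEq.fderiv_eq (f := id) h, fderiv_id]

/-- For a local multiplication `M` with unit `e`, the derivative at `e` of the adjoint action
`A x = (D₁M (e, x))⁻¹ ∘ D₂M (x, e)` is the bracket of left-invariant vector fields. -/
theorem hasFDerivAt_adjoint_of_localMul [CompleteSpace E] {M : E × E → E} {e : E}
    (hM : ContDiffAt ℝ 2 M (e, e))
    (h1 : ∀ᶠ x in 𝓝 e, M (x, e) = x) (h2 : ∀ᶠ x in 𝓝 e, M (e, x) = x) {A : E → E →L[ℝ] E}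
    (hA : ∀ᶠ x in 𝓝 e, fderiv ℝ (fun y => M (x, y)) e =
      (fderiv ℝ (fun z => M (z, x)) e).comp (A x)) (v : E) :
    ∃ L : E →L[ℝ] E, HasFDerivAt (fun x => A x v) L e ∧ ∀ u, L u =
      VectorField.lieBracket ℝ (fun x => fderiv ℝ (fun y => M (x, y)) e u)
        (fun x => fderiv ℝ (fun y => M (x, y)) e v) e := by
  have hF := hasFDerivAt_fderiv_prodMk_left hM
  have hR := hasFDerivAt_fderiv_prodMk_right hM
  set F : E → E →L[ℝ] E := fun x => fderiv ℝ (fun y => M (x, y)) e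
  set R : E → E →L[ℝ] E := fun x => fderiv ℝ (fun z => M (z, x)) e
  set D := fderiv ℝ (fderiv ℝ M) (e, e)
  have hFe : F e = 1 := fderiv_eq_id_of_eventually_eq h2
  have hRe : R e = 1 := fderiv_eq_id_of_eventually_eq h1
  have hinv : HasFDerivAt (fun x => Ring.inverse (R x)) _ e :=
    HasFDerivAt.comp e (g := Ring.inverse) (f := R)
      (by have := hasFDerivAt_ringInverse (𝕜 := ℝ) (1 : (E →L[ℝ] E)ˣ)
          rwa [Units.val_one, ← hRe] at this) hR
  have hprod := (hinv.clm_comp hF).clm_apply (hasFDerivAt_const v e)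
  have hunit : ∀ᶠ x in 𝓝 e, IsUnit (R x) :=
    hR.continuousAt.eventually (by rw [hRe]; exact Units.nhds (1 : (E →L[ℝ] E)ˣ))
  have heq : (fun x => A x v) =ᶠ[𝓝 e] fun x => ((Ring.inverse (R x)).comp (F x)) v := by
    filter_upwards [hA, hunit] with x hx hu
    have h3 : F x = R x * A x := hx
    have h4 : Ring.inverse (R x) * F x = A x := by
      rw [h3, ← mul_assoc, Ring.inverse_mul_cancel _ hu, one_mul]
    exact (congrArg (fun T : E →L[ℝ] E => T v) h4).symm
  refine ⟨_, hprod.congr_of_eventuallyEq heq, fun u => ?_⟩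
  have hsymm : IsSymmSndFDerivAt ℝ M (e, e) := hM.isSymmSndFDerivAt (by simp)
  have hFv (w : E) : HasFDerivAt (fun x => F x w) _ e := hF.clm_apply (hasFDerivAt_const w e)
  rw [VectorField.lieBracket, (hFv v).fderiv, (hFv u).fderiv]
  simp only [hFe, hRe, Ring.inverse_one]
  have hFw (w : E) : fderiv ℝ (fun y => M (e, y)) e w = w :=
    congrArg (fun T : E →L[ℝ] E => T w) hFe
  simp [hFw, hsymm.eq (v, 0) (0, u), D]
  abel

end Calculus

section Trapping

open Filter Topology Set

variable {E : Type*} [NormedAddCommGroup E] [NormedSpace ℝ E] [ProperSpace E]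
  {X : Type*} [TopologicalSpace X] [T2Space X]

/-- A curve that starts at the centre of a chart and has speed at most `b < ρ` as long as it stays
in the closed ball of radius `ρ` of the chart stays there up to time `1`. -/
theorem mem_source_and_norm_sub_le_of_norm_deriv_le {ψ : PartialEquiv X E} (hs : IsOpen ψ.source)
    (hψ : ContinuousOn ψ ψ.source) (hψ' : ContinuousOn ψ.symm ψ.target) {e : E} {ρ b : ℝ}
    (hρ : Metric.closedBall e ρ ⊆ ψ.target) (hb0 : 0 ≤ b) (hb : b < ρ) {c : ℝ → X}
    (hc : Continuous c) (hc0 : c 0 = ψ.symm e) {d : ℝ → E}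
    (hd : ∀ t ∈ Icc (0 : ℝ) 1, c t ∈ ψ.source → ψ (c t) ∈ Metric.closedBall e ρ →
      HasDerivAt (fun s => ψ (c s)) (d t) t ∧ ‖d t‖ ≤ b) :
    ∀ t ∈ Icc (0 : ℝ) 1, c t ∈ ψ.source ∧ ‖ψ (c t) - e‖ ≤ b * t := by
  have he : e ∈ Metric.closedBall e ρ := Metric.mem_closedBall_self (hb0.trans hb.le)
  have hKc : IsClosed (ψ.symm '' Metric.closedBall e ρ) :=
    ((isCompact_closedBall e ρ).image_of_continuousOn (hψ'.mono hρ)).isClosed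
  have hK {g : X} : g ∈ ψ.symm '' Metric.closedBall e ρ ↔
      g ∈ ψ.source ∧ ψ g ∈ Metric.closedBall e ρ := by
    constructor
    · rintro ⟨x, hx, rfl⟩
      exact ⟨ψ.map_target (hρ hx), by rwa [ψ.right_inv (hρ hx)]⟩
    · rintro ⟨h1, h2⟩
      exact ⟨ψ g, h2, ψ.left_inv h1⟩
  have hcont : ContinuousOn (fun t => ψ (c t)) (c ⁻¹' (ψ.symm '' Metric.closedBall e ρ)) :=
    hψ.comp hc.continuousOn fun t ht => (hK.1 ht).1
  have hclosed := ((hKc.preimage hc).isClosed_le (f := fun t => ‖ψ (c t) - e‖)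
    (g := fun t => b * t) (hcont.sub continuousOn_const).norm (by fun_prop)).inter
    (isClosed_Icc (a := (0 : ℝ)) (b := 1))
  have hsub := IsClosed.Icc_subset_of_forall_exists_gt hclosed ?_ ?_
  · exact fun t ht => ⟨(hK.1 (hsub ht).1).1, (hsub ht).2⟩
  · refine ⟨hK.2 ?_, ?_⟩
    · rw [hc0, ψ.right_inv (hρ he)]
      exact ⟨ψ.map_target (hρ he), he⟩
    · simp [hc0, ψ.right_inv (hρ he)]
  · rintro t ⟨⟨htK, htb⟩, ht⟩ y hy
    have hU : IsOpen (ψ.source ∩ ψ ⁻¹' Metric.ball e ρ) :=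
      hψ.isOpen_inter_preimage hs Metric.isOpen_ball
    have htU : t ∈ c ⁻¹' (ψ.source ∩ ψ ⁻¹' Metric.ball e ρ) := by
      refine ⟨(hK.1 htK).1, ?_⟩
      rw [mem_preimage, mem_ball_iff_norm]
      exact (htb.trans (mul_le_of_le_one_right hb0 ht.2.le)).trans_lt hb
    obtain ⟨δ, hδ, hball⟩ := Metric.isOpen_iff.1 (hU.preimage hc) t htU
    set t' := min (min y 1) (t + δ / 2)
    have htt' : t < t' := lt_min (lt_min hy ht.2) (by linarith)
    have ht'1 : t' ≤ 1 := (min_le_left _ _).trans (min_le_right _ _)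
    have hin : ∀ s ∈ Icc t t', c s ∈ ψ.source ∧ ψ (c s) ∈ Metric.ball e ρ := fun s hs' => by
      have hs2 : s ≤ t + δ / 2 := hs'.2.trans (min_le_right _ _)
      refine hball ?_
      rw [Metric.mem_ball, Real.dist_eq, abs_of_nonneg (by linarith [hs'.1])]
      linarith
    have hd' (s : ℝ) (hs' : s ∈ Icc t t') :=
      hd s ⟨ht.1.trans hs'.1, hs'.2.trans ht'1⟩ (hin s hs').1
        (Metric.ball_subset_closedBall (hin s hs').2)
    have hmv := norm_image_sub_le_of_norm_deriv_le_segment'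
      (fun s hs' => (hd' s hs').1.hasDerivWithinAt) (fun s hs' => (hd' s (Ico_subset_Icc_self hs')).2)
      t' ⟨htt'.le, le_rfl⟩
    refine ⟨t', ⟨hK.2 ⟨(hin t' ⟨htt'.le, le_rfl⟩).1,
      Metric.ball_subset_closedBall (hin t' ⟨htt'.le, le_rfl⟩).2⟩, ?_⟩,
      htt', (min_le_left _ _).trans (min_le_left _ _)⟩
    have htri := norm_add_le (ψ (c t') - ψ (c t)) (ψ (c t) - e)
    rw [sub_add_sub_cancel] at htri
    have htb' : ‖ψ (c t) - e‖ ≤ b * t := htb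
    change ‖ψ (c t') - e‖ ≤ b * t'
    linarith

end Trapping

section LocalGroup

open Filter Topology Set VectorField

set_option linter.unusedSectionVars false

variable {E : Type*} [NormedAddCommGroup E] [NormedSpace ℝ E]
  {H : Type*} [TopologicalSpace H] {I : ModelWithCorners ℝ E H} [I.Boundaryless]
  {G : Type*} [TopologicalSpace G] [ChartedSpace H G] [Group G] [LieGroup I ∞ G]

variable (I G) in
/-- The coordinates of the identity. -/
noncomputable def unitCoord : E := extChartAt I (1 : G) 1

variable (I) in
/-- A self-map of `G` in the chart at the identity. -/
noncomputable def chartRep (f : G → G) (x : E) : E :=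
  extChartAt I (1 : G) (f ((extChartAt I (1 : G)).symm x))

variable (I G) in
/-- The multiplication of `G` in the chart at the identity. -/
noncomputable def chartMul (p : E × E) : E :=
  extChartAt I (1 : G) ((extChartAt I (1 : G)).symm p.1 * (extChartAt I (1 : G)).symm p.2)

variable (I) in
/-- The adjoint action of `g`, in the chart at the identity. -/
noncomputable def chartAd (g : G) : E →L[ℝ] E :=
  fderiv ℝ (chartRep I fun x : G => g * x * g⁻¹) (unitCoord I G)

theorem symm_unitCoord : (extChartAt I (1 : G)).symm (unitCoord I G) = 1 :=
  extChartAt_to_inv (I := I) (1 : G)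

theorem target_mem_nhds : (extChartAt I (1 : G)).target ∈ 𝓝 (unitCoord I G) :=
  extChartAt_target_mem_nhds (I := I) (1 : G)

theorem contMDiffAt_chart {g : G} (hg : g ∈ (extChartAt I (1 : G)).source) :
    ContMDiffAt I 𝓘(ℝ, E) ∞ (extChartAt I (1 : G)) g :=
  contMDiffAt_extChartAt' (by rwa [← extChartAt_source I])

theorem contMDiffAt_chart_symm {x : E} (hx : x ∈ (extChartAt I (1 : G)).target) :
    ContMDiffAt 𝓘(ℝ, E) I ∞ (extChartAt I (1 : G)).symm x :=
  (contMDiffOn_extChartAt_symm (n := ∞) (1 : G)).contMDiffAt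
    ((isOpen_extChartAt_target (I := I) (1 : G)).mem_nhds hx)

theorem contDiffAt_chartRep {f : G → G} {x : E} (hx : x ∈ (extChartAt I (1 : G)).target)
    (hf : ContMDiff I I ∞ f)
    (hfx : f ((extChartAt I (1 : G)).symm x) ∈ (extChartAt I (1 : G)).source) :
    ContDiffAt ℝ ∞ (chartRep I f) x :=
  contMDiffAt_iff_contDiffAt.1 <|
    (contMDiffAt_chart hfx).comp x ((hf _).comp x (contMDiffAt_chart_symm hx))

theorem contDiffAt_chartRep_unit {f : G → G} (hf : ContMDiff I I ∞ f)
    (hf1 : f 1 ∈ (extChartAt I (1 : G)).source) :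
    ContDiffAt ℝ ∞ (chartRep I f) (unitCoord I G) :=
  contDiffAt_chartRep (mem_of_mem_nhds target_mem_nhds) hf (by rwa [symm_unitCoord])

theorem contDiffAt_chartMul :
    ContDiffAt ℝ ∞ (chartMul I G) (unitCoord I G, unitCoord I G) := by
  have he : unitCoord I G ∈ (extChartAt I (1 : G)).target := mem_of_mem_nhds target_mem_nhds
  have h1 : ContMDiffAt 𝓘(ℝ, E × E) I ∞ (fun p : E × E => (extChartAt I (1 : G)).symm p.1)
      (unitCoord I G, unitCoord I G) :=
    ContMDiffAt.comp (I' := 𝓘(ℝ, E)) (g := (extChartAt I (1 : G)).symm) _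
      (contMDiffAt_chart_symm he) contDiffAt_fst.contMDiffAt
  have h2 : ContMDiffAt 𝓘(ℝ, E × E) I ∞ (fun p : E × E => (extChartAt I (1 : G)).symm p.2)
      (unitCoord I G, unitCoord I G) :=
    ContMDiffAt.comp (I' := 𝓘(ℝ, E)) (g := (extChartAt I (1 : G)).symm) _
      (contMDiffAt_chart_symm he) contDiffAt_snd.contMDiffAt
  refine contMDiffAt_iff_contDiffAt.1 (ContMDiffAt.comp _ (contMDiffAt_chart ?_) (h1.mul h2))
  rw [symm_unitCoord, mul_one]
  exact mem_extChartAt_source (1 : G)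

theorem chartMul_unit_right {x : E} (hx : x ∈ (extChartAt I (1 : G)).target) :
    chartMul I G (x, unitCoord I G) = x := by
  rw [chartMul, symm_unitCoord, mul_one, (extChartAt I (1 : G)).right_inv hx]

theorem chartMul_unit_left {x : E} (hx : x ∈ (extChartAt I (1 : G)).target) :
    chartMul I G (unitCoord I G, x) = x := by
  rw [chartMul, symm_unitCoord, one_mul, (extChartAt I (1 : G)).right_inv hx]

theorem hasFDerivAt_chartMul : HasFDerivAt (chartMul I G)
    ((ContinuousLinearMap.fst ℝ E E) + ContinuousLinearMap.snd ℝ E E)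
    (unitCoord I G, unitCoord I G) := by
  have h := ((contDiffAt_chartMul (I := I) (G := G)).differentiableAt (by simp)).hasFDerivAt
  refine h.congr_fderiv ?_
  have hl := (h.comp (f := fun x => (x, unitCoord I G)) (unitCoord I G)
    (hasFDerivAt_prodMk_left _ _)).fderiv
  have hr := (h.comp (unitCoord I G) (hasFDerivAt_prodMk_right _ _)).fderiv
  have hl' := fderiv_eq_id_of_eventually_eq
    (mem_of_superset (target_mem_nhds (I := I) (G := G)) fun x hx => chartMul_unit_right hx)
  have hr' := fderiv_eq_id_of_eventually_eq
    (mem_of_superset (target_mem_nhds (I := I) (G := G)) fun x hx => chartMul_unit_left hx)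
  have hl'' := hl.symm.trans hl'
  have hr'' := hr.symm.trans hr'
  ext v
  · simpa using congrArg (fun T : E →L[ℝ] E => T v) hl''
  · simpa using congrArg (fun T : E →L[ℝ] E => T v) hr''

theorem mfderiv_chart_unit :
    mfderiv I 𝓘(ℝ, E) (extChartAt I (1 : G)) 1 = ContinuousLinearMap.id ℝ E := by
  have : IsManifold I 1 G := inferInstance
  exact mfderiv_extChartAt_self

theorem hasMFDerivAt_chart_symm_unit :
    HasMFDerivAt 𝓘(ℝ, E) I (extChartAt I (1 : G)).symm (unitCoord I G)
      (ContinuousLinearMap.id ℝ E) := by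
  have : IsManifold I 1 G := inferInstance
  have h := ((contMDiffAt_chart_symm (mem_of_mem_nhds
    (target_mem_nhds (I := I) (G := G)))).mdifferentiableAt (by simp)).hasMFDerivAt
  have h2 := mfderivWithin_range_extChartAt_symm (I := I) (x := (1 : G))
  rw [I.range_eq_univ, mfderivWithin_univ] at h2
  exact h.congr_mfderiv h2

/-- The left-invariant vector fields in the chart at the identity. -/
theorem mfderiv_chart_mulInvariantVectorField (v : GroupLieAlgebra I G) {g : G}
    (hg : g ∈ (extChartAt I (1 : G)).source) :
    mfderiv I 𝓘(ℝ, E) (extChartAt I (1 : G)) g (mulInvariantVectorField v g) =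
      fderiv ℝ (chartRep I (fun x : G => g * x)) (unitCoord I G) v := by
  have hL : HasMFDerivAt I I (fun x : G => g * x) 1 (mfderiv I I (fun x : G => g * x) 1) :=
    ((contMDiff_mul_left (I := I) (n := ∞) (a := g)).mdifferentiableAt (by simp)).hasMFDerivAt
  have hφ : HasMFDerivAt I 𝓘(ℝ, E) (extChartAt I (1 : G)) g
      (mfderiv I 𝓘(ℝ, E) (extChartAt I (1 : G)) g) :=
    ((contMDiffAt_chart hg).mdifferentiableAt (by simp)).hasMFDerivAt
  have aux {k : G} (hk : k = 1) :
      HasMFDerivAt I 𝓘(ℝ, E) (fun x : G => extChartAt I (1 : G) (g * x)) k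
      ((mfderiv I 𝓘(ℝ, E) (extChartAt I (1 : G)) g : E →L[ℝ] E).comp
        (mfderiv I I (fun x : G => g * x) 1 : E →L[ℝ] E)) := by
    subst hk
    refine HasMFDerivAt.comp (I' := I) (g := extChartAt I (1 : G)) 1 ?_ hL
    rw [mul_one]
    exact hφ
  have h := (aux symm_unitCoord).comp (unitCoord I G)
    hasMFDerivAt_chart_symm_unit
  have h' : HasFDerivAt (chartRep I fun x : G => g * x)
      ((mfderiv I 𝓘(ℝ, E) (extChartAt I (1 : G)) g : E →L[ℝ] E).comp
        (mfderiv I I (fun x : G => g * x) 1 : E →L[ℝ] E)) (unitCoord I G) :=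
    hasMFDerivAt_iff_hasFDerivAt.1 h
  have hv (D : E →L[ℝ] E) (hD : HasFDerivAt (chartRep I fun x : G => g * x) D (unitCoord I G)) :
      fderiv ℝ (chartRep I fun x : G => g * x) (unitCoord I G) v = D v := by rw [hD.fderiv]
  exact (hv _ h').symm

theorem chartRep_comp_eventuallyEq {f g : G → G} (hg : Continuous g)
    (hg1 : g 1 ∈ (extChartAt I (1 : G)).source) :
    chartRep I (f ∘ g) =ᶠ[𝓝 (unitCoord I G)] chartRep I f ∘ chartRep I g := by
  have hc : ContinuousAt (fun x => g ((extChartAt I (1 : G)).symm x)) (unitCoord I G) :=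
    hg.continuousAt.comp (contMDiffAt_chart_symm (mem_of_mem_nhds target_mem_nhds)).continuousAt
  have hs : (extChartAt I (1 : G)).source ∈ 𝓝 (g ((extChartAt I (1 : G)).symm (unitCoord I G))) :=
    (isOpen_extChartAt_source (I := I) (1 : G)).mem_nhds (by rwa [symm_unitCoord])
  filter_upwards [hc hs] with x hx
  simp only [chartRep, Function.comp_apply]
  rw [(extChartAt I (1 : G)).left_inv hx]

theorem chartRep_unit {f : G → G} (hf : f 1 = 1) :
    chartRep I f (unitCoord I G) = unitCoord I G := by
  rw [chartRep, symm_unitCoord, hf, unitCoord]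

theorem fderiv_chartRep_comp {f g : G → G} (hf : ContMDiff I I ∞ f) (hg : ContMDiff I I ∞ g)
    (hg1 : g 1 = 1) (hf1 : f 1 ∈ (extChartAt I (1 : G)).source) :
    fderiv ℝ (chartRep I (f ∘ g)) (unitCoord I G) =
      (fderiv ℝ (chartRep I f) (unitCoord I G)).comp
        (fderiv ℝ (chartRep I g) (unitCoord I G)) := by
  have hs : g 1 ∈ (extChartAt I (1 : G)).source := by
    rw [hg1]; exact mem_extChartAt_source (1 : G)
  rw [(chartRep_comp_eventuallyEq hg.continuous hs).fderiv_eq, fderiv_comp, chartRep_unit hg1]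
  · rw [chartRep_unit hg1]
    exact (contDiffAt_chartRep_unit hf hf1).differentiableAt (by simp)
  · exact (contDiffAt_chartRep_unit hg hs).differentiableAt (by simp)

theorem hasDerivAt_chart_comp {f : G → G} (hf : ContMDiff I I ∞ f)
    (hf1 : f 1 ∈ (extChartAt I (1 : G)).source) {c : ℝ → G} {t : ℝ} (hc : ContinuousAt c t)
    (hct : c t = 1) {c' : E} (hc' : HasDerivAt (fun s => extChartAt I (1 : G) (c s)) c' t) :
    HasDerivAt (fun s => extChartAt I (1 : G) (f (c s)))
      (fderiv ℝ (chartRep I f) (unitCoord I G) c') t := by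
  have hF : HasFDerivAt (chartRep I f) (fderiv ℝ (chartRep I f) (unitCoord I G))
      (extChartAt I (1 : G) (c t)) := by
    rw [hct]
    exact ((contDiffAt_chartRep_unit hf hf1).differentiableAt (by simp)).hasFDerivAt
  refine (hF.comp_hasDerivAt t hc').congr_of_eventuallyEq ?_
  have hs : (extChartAt I (1 : G)).source ∈ 𝓝 (c t) := by
    rw [hct]; exact extChartAt_source_mem_nhds (1 : G)
  filter_upwards [hc hs] with s hs'
  simp only [chartRep, Function.comp_apply]
  rw [(extChartAt I (1 : G)).left_inv hs']

theorem hasDerivAt_chart_mul {a b : ℝ → G} {t : ℝ} (ha : ContinuousAt a t) (hb : ContinuousAt b t)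
    (hat : a t = 1) (hbt : b t = 1) {a' b' : E}
    (ha' : HasDerivAt (fun s => extChartAt I (1 : G) (a s)) a' t)
    (hb' : HasDerivAt (fun s => extChartAt I (1 : G) (b s)) b' t) :
    HasDerivAt (fun s => extChartAt I (1 : G) (a s * b s)) (a' + b') t := by
  have hM : HasFDerivAt (chartMul I G) (ContinuousLinearMap.fst ℝ E E +
      ContinuousLinearMap.snd ℝ E E) (extChartAt I (1 : G) (a t), extChartAt I (1 : G) (b t)) := by
    rw [hat, hbt]
    exact hasFDerivAt_chartMul
  refine (hM.comp_hasDerivAt t (ha'.prodMk hb')).congr_of_eventuallyEq ?_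
  have hs : (extChartAt I (1 : G)).source ∈ 𝓝 (1 : G) := extChartAt_source_mem_nhds (1 : G)
  filter_upwards [ha.eventually_mem (by rwa [hat]), hb.eventually_mem (by rwa [hbt])] with s h1 h2
  simp only [chartMul, Function.comp_apply]
  rw [(extChartAt I (1 : G)).left_inv h1, (extChartAt I (1 : G)).left_inv h2]

theorem contMDiff_conj (g : G) : ContMDiff I I ∞ (fun x : G => g * x * g⁻¹) :=
  (contMDiff_mul_right (a := g⁻¹)).comp (contMDiff_mul_left (a := g))

theorem chartAd_mul (g h : G) : chartAd I (g * h) = (chartAd I g).comp (chartAd I h) := by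
  have hc : (fun x : G => g * h * x * (g * h)⁻¹) =
      (fun x : G => g * x * g⁻¹) ∘ fun x : G => h * x * h⁻¹ := by
    ext x; simp [mul_assoc]
  rw [chartAd, hc, fderiv_chartRep_comp (contMDiff_conj g) (contMDiff_conj h) (by simp)
    (by rw [mul_one, mul_inv_cancel]; exact mem_extChartAt_source (1 : G)), chartAd, chartAd]

theorem chartAd_one : chartAd I (1 : G) = ContinuousLinearMap.id ℝ E := by
  refine fderiv_eq_id_of_eventually_eq (mem_of_superset target_mem_nhds fun x hx => ?_)
  simp only [mem_ofPred_eq, chartRep, one_mul, inv_one, mul_one]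
  exact (extChartAt I (1 : G)).right_inv hx

theorem fderiv_chartRep_mul_left_eq {g : G} (hg : g ∈ (extChartAt I (1 : G)).source) :
    fderiv ℝ (chartRep I fun x : G => g * x) (unitCoord I G) =
      (fderiv ℝ (chartRep I fun x : G => x * g) (unitCoord I G)).comp (chartAd I g) := by
  have hc : (fun x : G => g * x) = (fun x : G => x * g) ∘ fun x : G => g * x * g⁻¹ := by
    ext x; simp [mul_assoc]
  rw [chartAd, ← fderiv_chartRep_comp contMDiff_mul_right (contMDiff_conj g) (by simp)
    (by rwa [one_mul]), ← hc]

/-- The Lie bracket of `𝔤` in the chart at the identity. -/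
theorem bracket_eq_lieBracket (u v : GroupLieAlgebra I G) :
    ⁅u, v⁆ = lieBracket ℝ
      (fun x => fderiv ℝ (fun y => chartMul I G (x, y)) (unitCoord I G) u)
      (fun x => fderiv ℝ (fun y => chartMul I G (x, y)) (unitCoord I G) v) (unitCoord I G) := by
  have : IsManifold I 1 G := inferInstance
  have hfield (w : GroupLieAlgebra I G) :
      mpullbackWithin 𝓘(ℝ, E) I (extChartAt I (1 : G)).symm (mulInvariantVectorField w) (range I)
        =ᶠ[𝓝 (unitCoord I G)]
      fun x => fderiv ℝ (fun y => chartMul I G (x, y)) (unitCoord I G) w := by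
    filter_upwards [target_mem_nhds] with x hx
    rw [mpullbackWithin_apply, ContinuousLinearMap.inverse_eq
      (mfderivWithin_extChartAt_symm_comp_mfderiv_extChartAt hx)
      (mfderiv_extChartAt_comp_mfderivWithin_extChartAt_symm hx)]
    exact mfderiv_chart_mulInvariantVectorField w ((extChartAt I (1 : G)).map_target hx)
  have hinv : (mfderiv I 𝓘(ℝ, E) (extChartAt I (1 : G)) 1).inverse =
      ContinuousLinearMap.id ℝ E := by
    rw [mfderiv_chart_unit]
    exact ContinuousLinearMap.inverse_id
  rw [GroupLieAlgebra.bracket_def, ← mlieBracketWithin_univ, mlieBracketWithin_apply]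
  refine (congrArg (fun T : E →L[ℝ] E => T _) hinv).trans ?_
  rw [ContinuousLinearMap.id_apply, preimage_univ, univ_inter]
  rw [I.range_eq_univ] at hfield ⊢
  refine (congrFun lieBracketWithin_univ _).trans ?_
  exact (hfield u).lieBracket_vectorField_eq (hfield v)

/-- The derivative of the adjoint action at the identity is the Lie bracket. -/
theorem exists_hasFDerivAt_chartAd [CompleteSpace E] (v : GroupLieAlgebra I G) :
    ∃ L : E →L[ℝ] E, HasFDerivAt (fun x => chartAd I ((extChartAt I (1 : G)).symm x) v) L
      (unitCoord I G) ∧ ∀ u : GroupLieAlgebra I G, L u = ⁅u, v⁆ := by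
  obtain ⟨L, hL, hLu⟩ := hasFDerivAt_adjoint_of_localMul
    (contDiffAt_chartMul.of_le (ENat.LEInfty.out))
    (mem_of_superset (target_mem_nhds (I := I) (G := G)) fun x hx => chartMul_unit_right hx)
    (mem_of_superset (target_mem_nhds (I := I) (G := G)) fun x hx => chartMul_unit_left hx)
    (A := fun x => chartAd I ((extChartAt I (1 : G)).symm x))
    (mem_of_superset (target_mem_nhds (I := I) (G := G)) fun x hx =>
      fderiv_chartRep_mul_left_eq ((extChartAt I (1 : G)).map_target hx)) v
  exact ⟨L, hL, fun u => (hLu u).trans (bracket_eq_lieBracket u v).symm⟩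

end LocalGroup

section OneParameter

open Filter Topology Set

set_option linter.unusedSectionVars false

variable {E : Type*} [NormedAddCommGroup E] [NormedSpace ℝ E] [FiniteDimensional ℝ E]
  {H : Type*} [TopologicalSpace H] {I : ModelWithCorners ℝ E H} [I.Boundaryless]
  {G : Type*} [TopologicalSpace G] [ChartedSpace H G] [Group G] [LieGroup I ∞ G] [T2Space G]

/-- The one-parameter subgroup with initial velocity `u`. -/
noncomputable def oneParam (u : GroupLieAlgebra I G) : ℝ → G :=
  (existsUnique_integralCurve u).choose

theorem oneParam_zero (u : GroupLieAlgebra I G) : oneParam u 0 = 1 :=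
  (existsUnique_integralCurve u).choose_spec.1.1

theorem isMIntegralCurve_oneParam (u : GroupLieAlgebra I G) :
    IsMIntegralCurve (I := I) (oneParam u) (mulInvariantVectorField u) :=
  (existsUnique_integralCurve u).choose_spec.1.2

theorem eq_oneParam {u : GroupLieAlgebra I G} {γ : ℝ → G} (h0 : γ 0 = 1)
    (hγ : IsMIntegralCurve (I := I) γ (mulInvariantVectorField u)) : γ = oneParam u :=
  (existsUnique_integralCurve u).choose_spec.2 γ ⟨h0, hγ⟩

theorem continuous_oneParam (u : GroupLieAlgebra I G) : Continuous (oneParam u) :=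
  (isMIntegralCurve_oneParam u).continuous

theorem _root_.IsMIntegralCurve.mul_left {u : GroupLieAlgebra I G} {γ : ℝ → G}
    (hγ : IsMIntegralCurve (I := I) γ (mulInvariantVectorField u)) (g : G) :
    IsMIntegralCurve (I := I) (fun t => g * γ t) (mulInvariantVectorField u) := by
  intro t
  have h1 : HasMFDerivAt I I (fun x : G => g * x) (γ t)
      (mfderiv I I (fun x : G => g * x) (γ t)) :=
    ((contMDiff_mul_left (I := I) (n := ∞) (a := g)).mdifferentiableAt (by simp)).hasMFDerivAt
  refine (h1.comp t (hγ t)).congr_mfderiv ?_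
  rw [mulInvariantVectorField_mul]
  ext
  exact (map_smul (mfderiv I I (fun x : G => g * x) (γ t)) (1 : ℝ) _)

theorem oneParam_add (u : GroupLieAlgebra I G) (s t : ℝ) :
    oneParam u (s + t) = oneParam u s * oneParam u t := by
  have h := eq_oneParam (u := u) (γ := fun t => (oneParam u s)⁻¹ * oneParam u (t + s)) (by simp)
    (((isMIntegralCurve_oneParam u).comp_add s).mul_left _)
  rw [← congrFun h t, mul_inv_cancel_left, add_comm]

theorem oneParam_neg (u : GroupLieAlgebra I G) (t : ℝ) : oneParam u (-t) = (oneParam u t)⁻¹ := by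
  rw [eq_inv_iff_mul_eq_one, ← oneParam_add, neg_add_cancel, oneParam_zero]

theorem oneParam_smul (u : GroupLieAlgebra I G) (a t : ℝ) :
    oneParam (a • u) t = oneParam u (t * a) := by
  have h : IsMIntegralCurve (I := I) (oneParam u ∘ (· * a)) (mulInvariantVectorField (a • u)) := by
    rw [mulInvariantVectorField_smul]
    exact (isMIntegralCurve_oneParam u).comp_mul a
  exact (congrFun (eq_oneParam (by simp [oneParam_zero]) h) t).symm

theorem lieExp_eq_oneParam (u : GroupLieAlgebra I G) : lieExp u = oneParam u 1 := rfl

theorem lieExp_neg (u : GroupLieAlgebra I G) : lieExp (-u) = (lieExp u)⁻¹ := by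
  rw [← neg_one_smul ℝ u, lieExp_eq_oneParam, oneParam_smul, one_mul, oneParam_neg]; rfl

theorem hasDerivAt_chart_oneParam_zero (u : GroupLieAlgebra I G) :
    HasDerivAt (fun t => extChartAt I (1 : G) (oneParam u t)) (u : E) 0 := by
  have hφ : HasMFDerivAt I 𝓘(ℝ, E) (extChartAt I (1 : G)) (oneParam u 0)
      (ContinuousLinearMap.id ℝ E) := by
    rw [oneParam_zero, ← mfderiv_chart_unit]
    exact ((contMDiffAt_chart (mem_extChartAt_source (1 : G))).mdifferentiableAt
      (by simp)).hasMFDerivAt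
  have hu : mulInvariantVectorField u (oneParam u 0) = (u : E) := by
    rw [oneParam_zero]
    have h1 : (fun x : G => 1 * x) = id := by ext x; simp
    rw [mulInvariantVectorField, h1, mfderiv_id]
    rfl
  have h := hφ.comp (0 : ℝ) (isMIntegralCurve_oneParam u 0)
  rw [hu] at h
  have h' : HasFDerivAt (fun t => extChartAt I (1 : G) (oneParam u t))
      ((ContinuousLinearMap.id ℝ E).comp ((1 : ℝ →L[ℝ] ℝ).smulRight (u : E))) 0 :=
    hasMFDerivAt_iff_hasFDerivAt.1 h
  exact h'.hasDerivAt.congr_deriv (one_smul ℝ (u : E))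

/-- `Ad (exp (t u)) = exp (t ad_u)`. -/
theorem chartAd_oneParam (u v : GroupLieAlgebra I G) (t : ℝ) :
    chartAd I (oneParam u t) v = (NormedSpace.exp (t • adL u) v : GroupLieAlgebra I G) := by
  have : CompleteSpace E := FiniteDimensional.complete ℝ E
  have : CompleteSpace (GroupLieAlgebra I G) := FiniteDimensional.complete ℝ _
  let f : ℝ → GroupLieAlgebra I G := fun t => chartAd I (oneParam u t) v
  have hf (t : ℝ) : HasDerivAt f (adL u (f t)) t := by
    obtain ⟨L, hL, hLu⟩ := exists_hasFDerivAt_chartAd (f t)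
    have hc : HasFDerivAt (fun x => chartAd I ((extChartAt I (1 : G)).symm x) (f t)) L
        (extChartAt I (1 : G) (oneParam u (t - t))) := by
      rw [sub_self, oneParam_zero]; exact hL
    have h0 : HasDerivAt (fun s => extChartAt I (1 : G) (oneParam u (s - t))) (u : E) t := by
      have := hasDerivAt_chart_oneParam_zero u
      rw [← sub_self t] at this
      exact this.comp_sub_const t t
    have h1 := hc.comp_hasDerivAt t h0
    rw [hLu u] at h1
    refine h1.congr_of_eventuallyEq ?_
    have hcont : ContinuousAt (fun s => oneParam u (s - t)) t :=
      ((continuous_oneParam u).comp (continuous_id.sub continuous_const)).continuousAt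
    filter_upwards [hcont.eventually_mem (show (extChartAt I (1 : G)).source ∈ _ by
      rw [sub_self, oneParam_zero]; exact extChartAt_source_mem_nhds (1 : G))] with s hs
    simp only [Function.comp_apply]
    rw [(extChartAt I (1 : G)).left_inv hs]
    change chartAd I (oneParam u s) v = chartAd I (oneParam u (s - t)) (chartAd I (oneParam u t) v)
    have hmul := chartAd_mul (I := I) (oneParam u (s - t)) (oneParam u t)
    rw [← oneParam_add, sub_add_cancel] at hmul
    exact congrArg (fun T : E →L[ℝ] E => T v) hmul
  have h := eq_exp_smul_apply_of_hasDerivAt (adL u) hf t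
  have hf0 : f 0 = v := by
    change chartAd I (oneParam u 0) v = v
    rw [oneParam_zero, chartAd_one]; rfl
  rw [hf0] at h
  exact h

/-- The curve `exp (t (u + v)) exp (-t u)`, which compares two one-parameter subgroups. -/
noncomputable def comparisonCurve (u v : GroupLieAlgebra I G) (t : ℝ) : G :=
  oneParam (u + v) t * oneParam u (-t)

theorem comparisonCurve_zero (u v : GroupLieAlgebra I G) : comparisonCurve u v 0 = 1 := by
  simp [comparisonCurve, oneParam_zero]

theorem continuous_comparisonCurve (u v : GroupLieAlgebra I G) :
    Continuous (comparisonCurve u v) := by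
  have : IsTopologicalGroup G := topologicalGroup_of_lieGroup I ∞
  exact (continuous_oneParam _).mul ((continuous_oneParam u).comp continuous_neg)

theorem comparisonCurve_eq (u v : GroupLieAlgebra I G) (s t : ℝ) :
    comparisonCurve u v s = comparisonCurve u v t *
      (oneParam u t * comparisonCurve u v (s - t) * (oneParam u t)⁻¹) := by
  have h1 := oneParam_add (u + v) t (s - t)
  have h2 := oneParam_add u (-(s - t)) (-t)
  rw [add_sub_cancel] at h1
  rw [show -(s - t) + -t = -s by ring] at h2
  simp only [comparisonCurve, h1, h2, oneParam_neg]
  group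

theorem lieExp_add_eq (u v : GroupLieAlgebra I G) :
    lieExp (u + v) = comparisonCurve u v 1 * lieExp u := by
  rw [comparisonCurve, oneParam_neg, lieExp_eq_oneParam, lieExp_eq_oneParam, inv_mul_cancel_right]

/-- `exp (t (u + v)) exp (-t u)` solves `η' = η · Ad (exp (t u)) v`. -/
theorem hasDerivAt_chart_comparisonCurve (u v : GroupLieAlgebra I G) {t : ℝ}
    (ht : comparisonCurve u v t ∈ (extChartAt I (1 : G)).source) :
    HasDerivAt (fun s => extChartAt I (1 : G) (comparisonCurve u v s))
      (fderiv ℝ (chartRep I fun x : G => comparisonCurve u v t * x) (unitCoord I G)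
        (NormedSpace.exp (t • adL u) v : GroupLieAlgebra I G)) t := by
  have h0 : HasDerivAt (fun s => extChartAt I (1 : G) (comparisonCurve u v s)) (v : E) 0 := by
    have hn : HasDerivAt (fun s => extChartAt I (1 : G) (oneParam u (-s))) (-u : E) 0 := by
      have h := hasDerivAt_chart_oneParam_zero u
      rw [← neg_zero] at h
      exact (h.scomp (0 : ℝ) (hasDerivAt_neg (0 : ℝ))).congr_deriv (neg_one_smul ℝ (u : E))
    have h := hasDerivAt_chart_mul (continuous_oneParam (u + v)).continuousAt
      ((continuous_oneParam u).comp continuous_neg).continuousAt (oneParam_zero _)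
      (by simp [oneParam_zero]) (hasDerivAt_chart_oneParam_zero (u + v)) hn
    exact h.congr_deriv (add_neg_cancel_comm (u : E) (v : E))
  have h1 : HasDerivAt (fun s => extChartAt I (1 : G) (comparisonCurve u v (s - t))) (v : E) t := by
    rw [← sub_self t] at h0
    exact h0.comp_sub_const t t
  have hcont : Continuous fun s => comparisonCurve u v (s - t) :=
    (continuous_comparisonCurve u v).comp (continuous_id.sub continuous_const)
  have hconj := contMDiff_conj (I := I) (oneParam u t)
  have h2 := hasDerivAt_chart_comp hconj
    (by rw [mul_one, mul_inv_cancel]; exact mem_extChartAt_source (1 : G)) hcont.continuousAt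
    (by rw [sub_self, comparisonCurve_zero]) h1
  have h3 := hasDerivAt_chart_comp (contMDiff_mul_left (a := comparisonCurve u v t))
    (by rwa [mul_one]) (hconj.continuous.comp hcont).continuousAt
    (by simp [comparisonCurve_zero]) h2
  rw [← chartAd_oneParam]
  refine h3.congr_of_eventuallyEq (Eventually.of_forall fun s => ?_)
  exact congrArg _ (comparisonCurve_eq u v s t)

end OneParameter

section Derivative

open Filter Topology Set

set_option linter.unusedSectionVars false

variable {E : Type*} [NormedAddCommGroup E] [NormedSpace ℝ E] [FiniteDimensional ℝ E]
  {H : Type*} [TopologicalSpace H] {I : ModelWithCorners ℝ E H} [I.Boundaryless]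
  {G : Type*} [TopologicalSpace G] [ChartedSpace H G] [Group G] [LieGroup I ∞ G] [T2Space G]

theorem exists_closedBall_norm_fderiv_mul_left_sub_id_le {ε : ℝ} (hε : 0 < ε) :
    ∃ ρ > 0, Metric.closedBall (unitCoord I G) ρ ⊆ (extChartAt I (1 : G)).target ∧
      ∀ g ∈ (extChartAt I (1 : G)).source,
        extChartAt I (1 : G) g ∈ Metric.closedBall (unitCoord I G) ρ →
        ‖fderiv ℝ (chartRep I fun x : G => g * x) (unitCoord I G) -
          ContinuousLinearMap.id ℝ E‖ ≤ ε := by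
  have hM := (contDiffAt_chartMul (I := I) (G := G)).of_le (m := 2) ENat.LEInfty.out
  have hc := (hasFDerivAt_fderiv_prodMk_left hM).continuousAt
  have hid : fderiv ℝ (fun y => chartMul I G (unitCoord I G, y)) (unitCoord I G) =
      ContinuousLinearMap.id ℝ E := fderiv_eq_id_of_eventually_eq
    (mem_of_superset (target_mem_nhds (I := I) (G := G)) fun x hx => chartMul_unit_left hx)
  have hball := hc.eventually (Metric.closedBall_mem_nhds _ hε)
  obtain ⟨ρ, hρ, hsub⟩ := Metric.nhds_basis_closedBall.mem_iff.1
    (inter_mem (target_mem_nhds (I := I) (G := G)) hball)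
  refine ⟨ρ, hρ, hsub.trans inter_subset_left, fun g hg hgρ => ?_⟩
  have h : dist (fderiv ℝ (fun y => chartMul I G (extChartAt I (1 : G) g, y)) (unitCoord I G))
      (fderiv ℝ (fun y => chartMul I G (unitCoord I G, y)) (unitCoord I G)) ≤ ε := (hsub hgρ).2
  rw [hid, dist_eq_norm] at h
  simpa only [chartMul, (extChartAt I (1 : G)).left_inv hg] using! h

theorem comparisonCurve_zero_right (u : GroupLieAlgebra I G) : comparisonCurve u 0 1 = 1 := by
  have h := lieExp_add_eq u 0
  rw [add_zero] at h
  exact mul_eq_right.1 h.symm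

/-- The coordinates of `exp (u + v) exp (-u)` in the chart at the identity. -/
noncomputable def chartComparison (u v : GroupLieAlgebra I G) : GroupLieAlgebra I G :=
  extChartAt I (1 : G) (comparisonCurve u v 1)

theorem chartComparison_zero (u : GroupLieAlgebra I G) : chartComparison u 0 = unitCoord I G := by
  rw [chartComparison, comparisonCurve_zero_right]; rfl

theorem comparisonCurve_estimate (u : GroupLieAlgebra I G) {ε : ℝ} (hε : 0 < ε) :
    ∃ δ > 0, ∀ v : GroupLieAlgebra I G, ‖v‖ < δ →
      comparisonCurve u v 1 ∈ (extChartAt I (1 : G)).source ∧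
      ‖chartComparison u v - chartComparison u 0 - phiSeries (adL u) v‖ ≤ ε * ‖v‖ := by
  have : CompleteSpace E := FiniteDimensional.complete ℝ E
  have : ProperSpace E := FiniteDimensional.proper_real E
  have : CompleteSpace (GroupLieAlgebra I G) := FiniteDimensional.complete ℝ _
  obtain ⟨M, hM, hexp⟩ := exists_norm_exp_smul_apply_le (adL u)
  obtain ⟨ρ, hρ, hsub, hF⟩ := exists_closedBall_norm_fderiv_mul_left_sub_id_le (I := I) (G := G)
    (div_pos hε hM)
  have hC : 0 < (ε / M + 1) * M := by positivity
  refine ⟨ρ / ((ε / M + 1) * M), by positivity, fun v hv => ?_⟩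
  rw [lt_div_iff₀ hC, mul_comm] at hv
  let w : ℝ → E := fun t => (NormedSpace.exp (t • adL u) v : GroupLieAlgebra I G)
  have hwc : Continuous w := continuous_exp_smul_apply (adL u) v
  have hw (t : ℝ) (ht : t ∈ Icc (0 : ℝ) 1) : ‖w t‖ ≤ M * ‖v‖ := hexp t ht v
  let F : ℝ → E →L[ℝ] E := fun t =>
    fderiv ℝ (chartRep I fun x : G => comparisonCurve u v t * x) (unitCoord I G)
  have hFw (t : ℝ) (ht : t ∈ Icc (0 : ℝ) 1)
      (hs : comparisonCurve u v t ∈ (extChartAt I (1 : G)).source)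
      (hb : extChartAt I (1 : G) (comparisonCurve u v t) ∈ Metric.closedBall (unitCoord I G) ρ) :
      ‖F t (w t) - w t‖ ≤ ε * ‖v‖ := by
    refine (ContinuousLinearMap.le_of_opNorm_le (F t - ContinuousLinearMap.id ℝ E)
      (hF _ hs hb) (w t)).trans ?_
    calc ε / M * ‖w t‖ ≤ ε / M * (M * ‖v‖) := by gcongr; exact hw t ht
      _ = ε * ‖v‖ := by field_simp
  have hstay := mem_source_and_norm_sub_le_of_norm_deriv_le
    (isOpen_extChartAt_source (I := I) (1 : G)) (continuousOn_extChartAt (I := I) (1 : G))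
    (continuousOn_extChartAt_symm (I := I) (1 : G)) hsub (b := (ε / M + 1) * M * ‖v‖)
    (by positivity) hv (continuous_comparisonCurve u v)
    (by rw [comparisonCurve_zero, symm_unitCoord]) (d := fun t => F t (w t))
    (fun t ht hs hb => ⟨hasDerivAt_chart_comparisonCurve u v hs, by
      have h1 := norm_add_le (F t (w t) - w t) (w t)
      rw [sub_add_cancel] at h1
      have h2 : (ε / M + 1) * M * ‖v‖ = ε * ‖v‖ + M * ‖v‖ := by field_simp
      rw [h2]
      exact h1.trans (add_le_add (hFw t ht hs hb) (hw t ht))⟩)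
  have hin (t : ℝ) (ht : t ∈ Icc (0 : ℝ) 1) :
      extChartAt I (1 : G) (comparisonCurve u v t) ∈ Metric.closedBall (unitCoord I G) ρ := by
    rw [mem_closedBall_iff_norm]
    exact ((hstay t ht).2.trans (mul_le_of_le_one_right (by positivity) ht.2)).trans hv.le
  refine ⟨(hstay 1 (by simp)).1, ?_⟩
  have hz (t : ℝ) (ht : t ∈ Icc (0 : ℝ) 1) :
      HasDerivWithinAt (fun t => extChartAt I (1 : G) (comparisonCurve u v t) -
        ∫ r in (0 : ℝ)..t, w r) (F t (w t) - w t) (Icc 0 1) t :=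
    ((hasDerivAt_chart_comparisonCurve u v (hstay t ht).1).sub
      (hwc.integral_hasStrictDerivAt 0 t).hasDerivAt).hasDerivWithinAt
  have hmv := norm_image_sub_le_of_norm_deriv_le_segment' hz
    (fun t ht => hFw t (Ico_subset_Icc_self ht) (hstay t (Ico_subset_Icc_self ht)).1
      (hin t (Ico_subset_Icc_self ht))) 1 (by simp)
  simp only [comparisonCurve_zero, intervalIntegral.integral_same, sub_zero, mul_one] at hmv
  rw [sub_right_comm] at hmv
  rw [phiSeries_apply, chartComparison_zero]
  exact hmv

theorem hasFDerivAt_chartComparison (u : GroupLieAlgebra I G) :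
    HasFDerivAt (chartComparison u) (phiSeries (adL u)) 0 := by
  rw [hasFDerivAt_iff_isLittleO_nhds_zero, Asymptotics.isLittleO_iff]
  intro ε hε
  obtain ⟨δ, hδ, h⟩ := comparisonCurve_estimate u hε
  filter_upwards [Metric.ball_mem_nhds (0 : GroupLieAlgebra I G) hδ] with v hv
  rw [zero_add]
  exact (h v (mem_ball_zero_iff.1 hv)).2

theorem hasMFDerivAt_lieExp (u : GroupLieAlgebra I G) :
    HasMFDerivAt 𝓘(ℝ, GroupLieAlgebra I G) I (lieExp : GroupLieAlgebra I G → G) u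
      ((mfderiv I I (fun g : G => g * lieExp u) 1 : E →L[ℝ] E).comp
        (phiSeries (adL u) : GroupLieAlgebra I G →L[ℝ] GroupLieAlgebra I G)) := by
  have h1 : HasMFDerivAt 𝓘(ℝ, GroupLieAlgebra I G) 𝓘(ℝ, GroupLieAlgebra I G)
      (fun w => chartComparison u (w - u)) u
      (phiSeries (adL u) : GroupLieAlgebra I G →L[ℝ] GroupLieAlgebra I G) := by
    refine hasMFDerivAt_iff_hasFDerivAt.2 ?_
    have h := hasFDerivAt_chartComparison u
    rw [← sub_self u] at h
    exact (HasFDerivAt.comp (f := fun w => w - u) u h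
      ((hasFDerivAt_id u).sub_const u)).congr_fderiv (ContinuousLinearMap.comp_id _)
  have hu : chartComparison u (u - u) = unitCoord I G := by
    rw [sub_self, chartComparison_zero]
  have h2 : HasMFDerivAt 𝓘(ℝ, GroupLieAlgebra I G) I
      (fun x : GroupLieAlgebra I G => (extChartAt I (1 : G)).symm x)
      (chartComparison u (u - u)) (ContinuousLinearMap.id ℝ E) := by
    rw [hu]
    exact hasMFDerivAt_chart_symm_unit (I := I) (G := G)
  have h3 : HasMFDerivAt I I (fun g : G => g * lieExp u)
      ((extChartAt I (1 : G)).symm (chartComparison u (u - u)))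
      (mfderiv I I (fun g : G => g * lieExp u) 1 : E →L[ℝ] E) := by
    rw [hu, symm_unitCoord]
    exact ((contMDiff_mul_right (I := I) (n := ∞)).mdifferentiableAt (by simp)).hasMFDerivAt
  have h4 := HasMFDerivAt.comp u (HasMFDerivAt.comp _ h3 h2) h1
  refine HasMFDerivAt.congr_of_eventuallyEq h4 ?_
  obtain ⟨δ, hδ, h⟩ := comparisonCurve_estimate u one_pos
  filter_upwards [Metric.ball_mem_nhds u hδ] with w hw
  have hs := (h (w - u) (mem_ball_iff_norm.1 hw)).1
  have h5 := lieExp_add_eq u (w - u)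
  rw [add_sub_cancel] at h5
  rw [h5]
  exact (congrArg (· * lieExp u) ((extChartAt I (1 : G)).left_inv hs)).symm

theorem tangentExp_eq (u : GroupLieAlgebra I G) :
    tangentExp u = ((mfderiv I I (fun g : G => g * lieExp u) 1 : E →L[ℝ] E).comp
        (phiSeries (adL u) : GroupLieAlgebra I G →L[ℝ] GroupLieAlgebra I G)) :=
  (hasMFDerivAt_lieExp u).mfderiv

theorem mfderiv_mul_right_inverse_comp (g h : G) (hgh : g * h = 1) :
    (mfderiv I I (fun x : G => x * h) g : E →L[ℝ] E).comp
      (mfderiv I I (fun x : G => x * g) 1 : E →L[ℝ] E) = ContinuousLinearMap.id ℝ E := by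
  have h1 : HasMFDerivAt I I (fun x : G => x * g) 1 (mfderiv I I (fun x : G => x * g) 1) :=
    ((contMDiff_mul_right (I := I) (n := ∞)).mdifferentiableAt (by simp)).hasMFDerivAt
  have h2 : HasMFDerivAt I I (fun x : G => x * h) (1 * g)
      (mfderiv I I (fun x : G => x * h) g : E →L[ℝ] E) := by
    rw [one_mul]
    exact ((contMDiff_mul_right (I := I) (n := ∞)).mdifferentiableAt (by simp)).hasMFDerivAt
  have h3 := h2.comp (1 : G) h1
  have hid : (fun x : G => x * h) ∘ (fun x : G => x * g) = id := by
    ext x; simp [mul_assoc, hgh]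
  rw [hid] at h3
  exact hasMFDerivAt_unique h3 (hasMFDerivAt_id (1 : G))

theorem dexp_eq_phiSeries (u : GroupLieAlgebra I G) : dexp u = phiSeries (adL u) := by
  have h := mfderiv_mul_right_inverse_comp (I := I) (lieExp u) (lieExp (-u))
    (by rw [lieExp_neg, mul_inv_cancel])
  ext v
  rw [dexp, tangentExp_eq]
  exact congrArg (fun T : E →L[ℝ] E => T (phiSeries (adL u) v : GroupLieAlgebra I G)) h

theorem hasMFDerivAt_lieExp_line (u v : GroupLieAlgebra I G) :
    HasMFDerivAt 𝓘(ℝ, ℝ) I (fun s : ℝ => lieExp (u + s • v)) 0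
      ((1 : ℝ →L[ℝ] ℝ).smulRight (tangentExp u v : E)) := by
  have h1 : HasMFDerivAt 𝓘(ℝ, GroupLieAlgebra I G) I (lieExp : GroupLieAlgebra I G → G)
      (u + (0 : ℝ) • v) (tangentExp u : E →L[ℝ] E) := by
    rw [zero_smul, add_zero]
    exact (hasMFDerivAt_lieExp u).mdifferentiableAt.hasMFDerivAt
  have h2 : HasFDerivAt (fun s : ℝ => u + s • v) ((1 : ℝ →L[ℝ] ℝ).smulRight v) 0 :=
    ((hasFDerivAt_id (0 : ℝ)).smul_const v).const_add u
  refine (h1.comp (0 : ℝ) (hasMFDerivAt_iff_hasFDerivAt.2 h2)).congr_mfderiv ?_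
  ext
  exact map_smul (tangentExp u : E →L[ℝ] E) (1 : ℝ) v

end Derivative

end LieExp

theorem mainTheorem4
    {E : Type*} [NormedAddCommGroup E] [NormedSpace ℝ E] [FiniteDimensional ℝ E]
    {H : Type*} [TopologicalSpace H] (I : ModelWithCorners ℝ E H) [I.Boundaryless]
    {G : Type*} [TopologicalSpace G] [ChartedSpace H G] [Group G] [LieGroup I ∞ G] [T2Space G]
    (u v : GroupLieAlgebra I G) :
    -- the tangent map of `exp` at `u` exists
    MDifferentiableAt 𝓘(ℝ, GroupLieAlgebra I G) I
        (LieExp.lieExp : GroupLieAlgebra I G → G) u ∧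
    -- `T_u exp (v) = d/ds exp (u + s v)` at `s = 0`
    HasMFDerivAt 𝓘(ℝ, ℝ) I (fun s : ℝ => LieExp.lieExp (u + s • v)) 0
        ((1 : ℝ →L[ℝ] ℝ).smulRight (LieExp.tangentExp u v)) ∧
    -- `T_u exp (v) = T R_{exp u} (dexp_u v) = dexp_u (v) · exp u`
    LieExp.tangentExp u v =
      mfderiv I I (fun g : G => g * LieExp.lieExp u) 1 (LieExp.dexp u v) ∧
    -- `dexp_u (v) = ∫₀¹ exp (r ad_u) (v) dr`
    IntervalIntegrable (fun r : ℝ => NormedSpace.exp (r • LieExp.adL u) v)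
        MeasureTheory.volume 0 1 ∧
    LieExp.dexp u v = ∫ r in (0 : ℝ)..1, NormedSpace.exp (r • LieExp.adL u) v ∧
    -- `dexp_u = ((e ^ z - 1) / z)` evaluated at `z = ad_u`
    LieExp.IsEntireEval LieExp.phi (LieExp.adL u) (LieExp.dexp u) := by
  have : CompleteSpace (GroupLieAlgebra I G) := FiniteDimensional.complete ℝ _
  refine ⟨(LieExp.hasMFDerivAt_lieExp u).mdifferentiableAt, LieExp.hasMFDerivAt_lieExp_line u v,
    ?_, (LieExp.continuous_exp_smul_apply (LieExp.adL u) v).intervalIntegrable 0 1, ?_, ?_⟩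
  · rw [LieExp.dexp_eq_phiSeries, LieExp.tangentExp_eq]
    rfl
  · rw [LieExp.dexp_eq_phiSeries]
    exact LieExp.phiSeries_apply (LieExp.adL u) v
  · rw [LieExp.dexp_eq_phiSeries]
    exact LieExp.isEntireEval_phi (LieExp.adL u)
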